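/- Let $n \ge 3$ be an integer and let $T$ be a finite tree of maximum degree $n+1$ that has a unique vertex $r$ of degree $n+1$ and is such that every connected component of $T-r$ has maximum degree at most $n-1$. Then there is an integer $k \ge 2$ such that the graph $\Box^n K_k$ is $T$-induced-saturated. Here $\Box^n K_k$ is the Cartesian product of $n$ cliques of order $k$, i.e. the graph whose vertices are the $n$-tuples with entries in a $k$-element set, two tuples being adjacent if and only if they differ in exactly one coordinate; and a graph $G$ is called $H$-induced-saturated if $G$ has no induced subgraph isomorphic to $H$, but deleting any edge of $G$, or adding to $G$ any edge of its complement, yields a graph that has an induced subgraph isomorphic to $H$. -/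

import Mathlib

/-- The Cartesian product of `n` complete graphs on `k` vertices: the vertices are the `n`-tuples
with entries in a `k`-element set, and two tuples are adjacent if and only if they differ in
exactly one coordinate. -/
def cliquePower (n k : ℕ) : SimpleGraph (Fin n → Fin k) where
  Adj u v := ∃! i, u i ≠ v i
  symm := ⟨fun _ _ ⟨i, hi, hu⟩ => ⟨i, hi.symm, fun j hj => hu j hj.symm⟩⟩
  loopless := ⟨fun _ ⟨_, hi, _⟩ => hi rfl⟩

/-- `G` is `H`-induced-saturated: `G` has no induced copy of `H`, but deleting any edge of `G`, or
adding to `G` any edge of its complement, creates an induced copy of `H`. -/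
def InducedSaturated {W V : Type*} (G : SimpleGraph W) (H : SimpleGraph V) : Prop :=
  ¬ H.IsIndContained G ∧
    (∀ u v : W, G.Adj u v → H.IsIndContained (G.deleteEdges {s(u, v)})) ∧
    (∀ u v : W, Gᶜ.Adj u v → H.IsIndContained (G ⊔ SimpleGraph.edge u v))

open Classical in
/-- `T` is a tree of maximum degree `n + 1` with a unique vertex `r` of degree `n + 1`, such that
every connected component of `T - r` has maximum degree at most `n - 1`. -/
def IsUniqueMaxTree {V : Type*} [Fintype V] (n : ℕ) (T : SimpleGraph V) : Prop :=
  T.IsTree ∧ T.maxDegree = n + 1 ∧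
    ∃ r : V, T.degree r = n + 1 ∧ (∀ v : V, T.degree v = n + 1 → v = r) ∧
      ∀ C : (T.induce {v | v ≠ r}).ConnectedComponent, C.toSimpleGraph.maxDegree ≤ n - 1

/-!
The argument turns labellings of the edges of the tree `T` by nonempty sets of coordinates into maps
from `T` to the clique power: the `i`-th coordinate of the image of `x` records the component of `x`
in the forest obtained from `T` by deleting the edges whose label contains `i`
(`SimpleGraph.IsTree.exists_labelling_map`). The images of `x` and `y` then differ exactly in the
coordinates that occur in a label on the path from `x` to `y`, so they are adjacent if and only if
these labels are all equal to one and the same singleton. If the labelling is a proper edge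
colouring, this happens only for paths of length one, and the map is an induced embedding. Since
the components can be numbered freely, the images of two vertices may be prescribed, as long as
they differ in the right coordinates.

The root `r` has `n + 1` neighbours, one too many for a proper colouring with `n` colours, and all
other vertices have degree at most `n`. This is why there is no induced copy in the clique power
itself: the neighbours of a vertex are covered by `n` cliques
(`not_isIndContained_cliquePower`). It is also why changing one edge suffices.

* When an edge `u v` in direction `i` is deleted, two edges `r a` and `r b` get the colour `i`, and
  the colouring is proper otherwise. The only surplus adjacency is between the images of `a` and
  `b`, which can be taken to be `u` and `v` (`isIndContained_deleteEdges`).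
* When an edge `u v` is added, one edge `r a` is labelled by the set of the at least two coordinates
  in which `u` and `v` differ, and the others are properly coloured. The only adjacency that gets
  lost is that of `r` and `a`, which can be mapped to `u` and `v` (`isIndContained_sup_edge`).

The colourings are built outwards from the root, with arbitrary prescribed colours at the root
(`SimpleGraph.IsTree.exists_edge_coloring`).
-/

open SimpleGraph

/-! ### Rooted trees and edge colourings -/

theorem SimpleGraph.IsTree.eq_of_dist_succ {V : Type*} {T : SimpleGraph V} (hT : T.IsTree)
    {r y z w : V} (hz : T.Adj z y) (hw : T.Adj w y) (hzd : T.dist r z + 1 = T.dist r y)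
    (hwd : T.dist r w + 1 = T.dist r y) : z = w := by
  obtain ⟨p, hp⟩ := (hT.connected r z).exists_walk_length_eq_dist
  obtain ⟨q, hq⟩ := (hT.connected r w).exists_walk_length_eq_dist
  have h1 : (p.concat hz).IsPath := Walk.isPath_of_length_eq_dist _ (by simp [hp, hzd])
  have h2 : (q.concat hw).IsPath := Walk.isPath_of_length_eq_dist _ (by simp [hq, hwd])
  have h := congrArg Subtype.val ((hT.isAcyclic.subsingleton_path r y).elim ⟨_, h1⟩ ⟨_, h2⟩)
  simpa using congrArg Walk.penultimate h

theorem SimpleGraph.IsTree.not_adj_of_adj {V : Type*} {T : SimpleGraph V} (hT : T.IsTree)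
    {r x y : V} (hx : T.Adj r x) (hy : T.Adj r y) : ¬ T.Adj x y := fun h =>
  hT.dist_ne_of_adj r h ((dist_eq_one_iff_adj.2 hx).trans (dist_eq_one_iff_adj.2 hy).symm)

/-- The function `p` sends each vertex to its parent when `T` is rooted at `r`. -/
theorem SimpleGraph.IsTree.exists_parent {V : Type*} {T : SimpleGraph V} (hT : T.IsTree)
    (r : V) : ∃ p : V → V, (∀ y, y ≠ r → T.Adj (p y) y ∧ T.dist r (p y) + 1 = T.dist r y) ∧
      ∀ y z, T.Adj y z → (z ≠ r ∧ p z = y ∧ T.dist r y + 1 = T.dist r z) ∨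
        (y ≠ r ∧ p y = z ∧ T.dist r z + 1 = T.dist r y) := by
  have hex : ∀ y, ∃ q, y ≠ r → T.Adj q y ∧ T.dist r q + 1 = T.dist r y := by
    intro y
    by_cases hy : y = r
    · exact ⟨r, fun h => absurd hy h⟩
    obtain ⟨w, hw⟩ := (hT.connected r y).exists_walk_length_eq_dist
    have hnil : ¬ w.Nil := fun h => hy h.eq.symm
    have hadj := w.adj_penultimate hnil
    refine ⟨w.penultimate, fun _ => ⟨hadj, ?_⟩⟩
    have h1 := dist_le w.dropLast
    have h2 : w.dropLast.length + 1 = w.length := by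
      rw [← Walk.length_concat _ hadj, w.concat_dropLast hadj]
    rcases hT.dist_eq_dist_add_one_of_adj r hadj with h | h <;> omega
  choose p hp using hex
  refine ⟨p, hp, ?_⟩
  have key : ∀ y z, T.Adj y z → T.dist r y + 1 = T.dist r z → z ≠ r ∧ p z = y := by
    intro y z h hd
    have hz : z ≠ r := by rintro rfl; simp at hd
    exact ⟨hz, hT.eq_of_dist_succ (hp z hz).1 h (hp z hz).2 hd⟩
  intro y z h
  rcases hT.dist_eq_dist_add_one_of_adj r h with hd | hd
  · exact .inr ⟨(key z y h.symm hd.symm).1, (key z y h.symm hd.symm).2, hd.symm⟩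
  · exact .inl ⟨(key y z h hd.symm).1, (key y z h hd.symm).2, hd.symm⟩

/-- The edges at the root may be coloured arbitrarily; going outwards, the colours at each further
vertex are any injective choice, permuted so as to match the colour of the edge to the parent. -/
theorem SimpleGraph.IsTree.exists_edge_coloring {V α : Type*} [Nonempty α]
    {T : SimpleGraph V} (hT : T.IsTree) (r : V) (c₀ : T.neighborSet r → α)
    (hdeg : ∀ y, y ≠ r → ∃ e : V → α, Set.InjOn e (T.neighborSet y)) :
    ∃ c : Sym2 V → α, (∀ x : T.neighborSet r, c s(r, x) = c₀ x) ∧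
      ∀ y, y ≠ r → Set.InjOn (fun x => c s(y, x)) (T.neighborSet y) := by
  classical
  obtain ⟨c₁, hc₁⟩ : ∃ c₁ : V → α, ∀ x : T.neighborSet r, c₁ x = c₀ x :=
    ⟨fun x => if h : T.Adj r x then c₀ ⟨x, h⟩ else Classical.arbitrary α, fun x => dif_pos x.2⟩
  have hdeg' : ∀ y, ∃ e : V → α, y ≠ r → Set.InjOn e (T.neighborSet y) := by
    intro y
    by_cases hy : y = r
    · exact ⟨c₁, fun h => absurd hy h⟩
    · exact (hdeg y hy).imp fun e he _ => he
  choose e he using hdeg'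
  obtain ⟨p, hp, hadj⟩ := hT.exists_parent r
  -- `aux m x` is the colour of the edge from `x` to its parent when `x` is at depth `m + 1`.
  let aux : ℕ → V → α := fun m => Nat.rec c₁
    (fun _ g x => Equiv.swap (e (p x) (p (p x))) (g (p x)) (e (p x) x)) m
  let col : V → α := fun x => aux (T.dist r x - 1) x
  have hcol : ∀ x, x ≠ r → p x ≠ r →
      col x = Equiv.swap (e (p x) (p (p x))) (col (p x)) (e (p x) x) := by
    intro x hx hpx
    have h1 := (hp x hx).2
    have h2 := (hp _ hpx).2
    have h3 : T.dist r x - 1 = (T.dist r (p x) - 1) + 1 := by omega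
    simp only [col, h3]
    rfl
  have hcol₀ : ∀ x, x ≠ r → p x = r → col x = c₁ x := by
    intro x hx hpx
    have h1 := (hp x hx).2
    have h3 : T.dist r x - 1 = 0 := by rw [hpx, dist_self] at h1; omega
    simp only [col, h3]
    rfl
  let c : Sym2 V → α := Sym2.lift ⟨fun x y => if T.dist r x < T.dist r y then col y else
    if T.dist r y < T.dist r x then col x else c₁ r, fun x y => by
      rcases lt_trichotomy (T.dist r x) (T.dist r y) with h | h | h
      · simp [h, h.not_gt]
      · simp [h]
      · simp [h, h.not_gt]⟩
  have hc : ∀ x y, T.dist r x + 1 = T.dist r y → c s(x, y) = col y := by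
    intro x y h
    simp only [c, Sym2.lift_mk]
    rw [if_pos (by omega)]
  refine ⟨c, fun x => ?_, fun y hy => ?_⟩
  · rcases hadj r x x.2 with ⟨h1, h2, h3⟩ | ⟨h1, -⟩
    · rw [hc _ _ h3, hcol₀ x h1 h2, hc₁]
    · exact absurd rfl h1
  · have : Set.EqOn (fun x => c s(y, x))
        (fun x => Equiv.swap (e y (p y)) (col y) (e y x)) (T.neighborSet y) := by
      intro x hx
      rcases hadj y x hx with ⟨h1, rfl, h3⟩ | ⟨-, rfl, h3⟩
      · exact (hc _ _ h3).trans (hcol x h1 hy)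
      · simp only
        rw [Sym2.eq_swap, hc _ _ h3, Equiv.swap_apply_left]
    exact this.injOn_iff.2 ((Equiv.injective _).comp_injOn (he y hy))

/-! ### From edge labellings to maps into the clique power -/

theorem exists_injective_apply_eq {α β : Type*} [Fintype α] [Fintype β]
    (h : Fintype.card α ≤ Fintype.card β) (a b : α) (u v : β) (huv : u ≠ v ↔ a ≠ b) :
    ∃ g : α → β, Function.Injective g ∧ g a = u ∧ g b = v := by
  classical
  obtain ⟨g⟩ := Function.Embedding.nonempty_of_card_le h
  let g' : α → β := fun x => Equiv.swap (g a) u (g x)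
  have hg' : Function.Injective g' := (Equiv.injective _).comp g.injective
  have ha : g' a = u := Equiv.swap_apply_left _ _
  refine ⟨fun x => Equiv.swap (g' b) v (g' x), (Equiv.injective _).comp hg', ?_,
    Equiv.swap_apply_left _ _⟩
  by_cases hab : a = b
  · subst hab
    exact (Equiv.swap_apply_left _ _).trans (not_not.1 (mt huv.1 (by simp))).symm
  · refine (Equiv.swap_apply_of_ne_of_ne (hg'.ne hab) ?_).trans ha
    exact ha.symm ▸ huv.2 hab

theorem SimpleGraph.IsTree.reachable_deleteEdges_iff {V : Type*} {T : SimpleGraph V}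
    (hT : T.IsTree) (E : Set (Sym2 V)) {x y : V} {p : T.Walk x y} (hp : p.IsPath) :
    (T.deleteEdges E).Reachable x y ↔ ∀ e ∈ p.edges, e ∉ E := by
  constructor
  · intro h
    obtain ⟨q, hq⟩ := h.exists_isPath
    have hle := T.deleteEdges_le E
    have h := congrArg Subtype.val ((hT.isAcyclic.subsingleton_path x y).elim ⟨p, hp⟩ ⟨_, hq.mapLe hle⟩)
    simp only at h
    intro e he heE
    rw [h, Walk.edges_mapLe_eq_edges] at he
    have := q.edges_subset_edgeSet he
    rw [edgeSet_deleteEdges] at this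
    exact this.2 heE
  · exact fun h => ⟨p.toDeleteEdges E h⟩

/-- The `i`-th coordinate of a vertex is its component in the forest left after deleting the edges
whose label contains `i`. -/
theorem SimpleGraph.IsTree.exists_labelling_map {V ι : Type*} [Fintype V] {T : SimpleGraph V}
    (hT : T.IsTree) (S : Sym2 V → Set ι) {k : ℕ} (hk : Fintype.card V ≤ k) {a b : V}
    {p : T.Walk a b} (hp : p.IsPath) (u v : ι → Fin k)
    (huv : ∀ i, u i ≠ v i ↔ ∃ e ∈ p.edges, i ∈ S e) :
    ∃ f : V → ι → Fin k, f a = u ∧ f b = v ∧ ∀ x y (q : T.Walk x y), q.IsPath →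
      ∀ i, f x i ≠ f y i ↔ ∃ e ∈ q.edges, i ∈ S e := by
  classical
  let G : ι → SimpleGraph V := fun i => T.deleteEdges {e | i ∈ S e}
  have hG : ∀ i x y (q : T.Walk x y), q.IsPath →
      ((G i).connectedComponentMk x ≠ (G i).connectedComponentMk y ↔
        ∃ e ∈ q.edges, i ∈ S e) := by
    intro i x y q hq
    rw [Ne, ConnectedComponent.eq, hT.reachable_deleteEdges_iff _ hq]
    simp
  have hg : ∀ i, ∃ g : (G i).ConnectedComponent → Fin k, Function.Injective g ∧
      g ((G i).connectedComponentMk a) = u i ∧ g ((G i).connectedComponentMk b) = v i := by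
    intro i
    apply exists_injective_apply_eq
    · rw [Fintype.card_fin]
      refine (Fintype.card_le_of_surjective (G i).connectedComponentMk fun C => ?_).trans hk
      exact C.exists_rep
    · rw [huv, hG _ _ _ _ hp]
  choose g hg ha hb using hg
  refine ⟨fun x i => g i ((G i).connectedComponentMk x), funext ha, funext hb, ?_⟩
  intro x y q hq i
  rw [(hg i).ne_iff, hG _ _ _ _ hq]

/-- If the union of the labels along a path is a single coordinate, then any two consecutive
edges have the same one-element label. As this happens only at `r`, and only for the pairs of ends
in `M`, the path has at most two edges. -/
theorem SimpleGraph.Walk.IsPath.adj_or_mem_of_existsUnique {V ι : Type*} {T : SimpleGraph V}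
    {S : Sym2 V → Set ι} (hS : ∀ e, (S e).Nonempty) {r : V} {M : Set (Sym2 V)}
    (hM : ∀ x y z, T.Adj x y → T.Adj y z → x ≠ z → ∀ i, S s(x, y) = {i} → S s(y, z) = {i} →
      y = r ∧ s(x, z) ∈ M) {x y : V} {p : T.Walk x y} (hp : p.IsPath)
    (h : ∃! i, ∃ e ∈ p.edges, i ∈ S e) : T.Adj x y ∨ s(x, y) ∈ M := by
  obtain ⟨i, hi, huniq⟩ := h
  have hS' : ∀ e ∈ p.edges, S e = {i} := fun e he =>
    (hS e).subset_singleton_iff.1 fun j hj => huniq j ⟨e, he, hj⟩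
  match p, hp with
  | .nil, _ => simp at hi
  | .cons h1 .nil, _ => exact .inl h1
  | .cons h1 (.cons h2 .nil), hp =>
    refine .inr (hM _ _ _ h1 h2 ?_ i (hS' _ (by simp)) (hS' _ (by simp))).2
    rintro rfl
    simp at hp
  | .cons h1 (.cons h2 (.cons h3 q)), hp =>
    exfalso
    rw [Walk.cons_isPath_iff, Walk.cons_isPath_iff] at hp
    have e1 := (hM _ _ _ h1 h2 (by rintro rfl; simp at hp) i
      (hS' _ (by simp)) (hS' _ (by simp))).1
    have e2 := (hM _ _ _ h2 h3 (by rintro rfl; simp at hp) i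
      (hS' _ (by simp)) (hS' _ (by simp))).1
    exact h2.ne (e1.trans e2.symm)

/-- The labelling map is injective; it preserves the edges with one-element label, and its only
adjacent nonedges are the pairs in `M`. -/
theorem SimpleGraph.IsTree.exists_map_cliquePower {V : Type*} [Fintype V] {T : SimpleGraph V}
    (hT : T.IsTree) {n k : ℕ} (hk : Fintype.card V ≤ k) (S : Sym2 V → Set (Fin n))
    (hS : ∀ e, (S e).Nonempty) {r : V} {M : Set (Sym2 V)}
    (hM : ∀ x y z, T.Adj x y → T.Adj y z → x ≠ z → ∀ i, S s(x, y) = {i} → S s(y, z) = {i} →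
      y = r ∧ s(x, z) ∈ M) {a b : V} {p : T.Walk a b} (hp : p.IsPath) (u v : Fin n → Fin k)
    (huv : ∀ i, u i ≠ v i ↔ ∃ e ∈ p.edges, i ∈ S e) :
    ∃ f : V → Fin n → Fin k, f a = u ∧ f b = v ∧ Function.Injective f ∧
      (∀ x y, T.Adj x y → ∀ i, S s(x, y) = {i} → (cliquePower n k).Adj (f x) (f y)) ∧
      ∀ x y, (cliquePower n k).Adj (f x) (f y) → T.Adj x y ∨ s(x, y) ∈ M := by
  obtain ⟨f, hfa, hfb, hf⟩ := hT.exists_labelling_map S hk hp u v huv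
  refine ⟨f, hfa, hfb, ?_, ?_, ?_⟩
  · intro x y hxy
    by_contra hne
    obtain ⟨q, hq⟩ := (hT.connected x y).exists_isPath
    cases q with
    | nil => exact hne rfl
    | cons h q =>
      obtain ⟨i, hi⟩ := hS s(_, _)
      exact (hf _ _ _ hq i).2 ⟨_, List.mem_cons_self, hi⟩ (by rw [hxy])
  · intro x y h i hi
    have hq : (Walk.cons h .nil).IsPath := by simp [h.ne]
    change ∃! i, f x i ≠ f y i
    simp_rw [hf _ _ _ hq]
    simp [hi]
  · intro x y h
    obtain ⟨q, hq⟩ := (hT.connected x y).exists_isPath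
    refine hq.adj_or_mem_of_existsUnique hS hM ?_
    have h' : ∃! i, f x i ≠ f y i := h
    simpa only [hf _ _ _ hq] using h'

/-! ### Induced copies in the clique power and its modifications -/

/-- Two of the `n + 1` pairwise nonadjacent neighbours of `r` would have to lie on the same line
through the image of `r`, but lines are cliques. -/
theorem not_isIndContained_cliquePower {V : Type*} {T : SimpleGraph V} (hT : T.IsTree)
    {r : V} {n : ℕ} (e : T.neighborSet r ≃ Option (Fin n)) (k : ℕ) :
    ¬ T.IsIndContained (cliquePower n k) := by
  rintro ⟨f⟩
  have hadj : ∀ x : T.neighborSet r, ∃! i, f r i ≠ f x i := fun x => f.map_rel_iff.2 x.2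
  choose d hd huniq using hadj
  have hninj : ¬ Function.Injective (fun o => d (e.symm o)) := fun hinj => by
    simpa using Fintype.card_le_of_injective _ hinj
  simp only [Function.Injective, not_forall] at hninj
  obtain ⟨o₁, o₂, hd12, hne⟩ := hninj
  set x := e.symm o₁
  set z := e.symm o₂
  have hxz : x ≠ z := fun h => hne (e.symm.injective h)
  have hoff : ∀ j, j ≠ d x → f x j = f z j := by
    intro j hj
    have h1 : f r j = f x j := by_contra fun h => hj (huniq x j h)
    have h2 : f r j = f z j := by_contra fun h => hj ((huniq z j h).trans hd12.symm)
    exact h1.symm.trans h2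
  have : (cliquePower n k).Adj (f x) (f z) := by
    refine ⟨d x, fun h => hxz ?_, fun j hj => by_contra fun h => hj (hoff j h)⟩
    refine Subtype.ext (f.injective (funext fun j => ?_))
    by_cases hj : j = d x
    · exact hj ▸ h
    · exact hoff j hj
  have hT' : T.Adj x z := f.map_rel_iff.1 this
  exact hT.not_adj_of_adj x.2 z.2 hT'

/-- The common neighbour `r` of the preimages of `u` and `v` has two edges of the colour in which
`u` and `v` differ; the labelling is proper otherwise. -/
theorem isIndContained_deleteEdges {V : Type*} [Fintype V] {T : SimpleGraph V} (hT : T.IsTree)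
    {r : V} {n : ℕ} (e : T.neighborSet r ≃ Option (Fin n))
    (hdeg : ∀ y, y ≠ r → ∃ e : V → Fin n, Set.InjOn e (T.neighborSet y)) {k : ℕ}
    (hk : Fintype.card V ≤ k) {u v : Fin n → Fin k} (huv : (cliquePower n k).Adj u v) :
    T.IsIndContained ((cliquePower n k).deleteEdges {s(u, v)}) := by
  classical
  obtain ⟨i₀, hi₀, huniq⟩ := huv
  have : Nonempty (Fin n) := ⟨i₀⟩
  obtain ⟨c, hc', hinj⟩ := hT.exists_edge_coloring r (fun x => (e x).getD i₀) hdeg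
  set a := e.symm none with ha
  set b := e.symm (some i₀) with hb
  have hab : (a : V) ≠ b := fun h => by simpa [ha, hb] using Subtype.ext h
  have hra : T.Adj r a := a.2
  have hrb : T.Adj r b := b.2
  let p : T.Walk a b := .cons hra.symm (.cons hrb .nil)
  have hp : p.IsPath := by simp [p, hra.ne', hrb.ne, hab]
  have hca : c s(r, a) = i₀ := by simp [hc', ha]
  have hcb : c s(r, b) = i₀ := by simp [hc', hb]
  have hM : ∀ x y z, T.Adj x y → T.Adj y z → x ≠ z → ∀ i, ({c s(x, y)} : Set (Fin n)) = {i} →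
      ({c s(y, z)} : Set (Fin n)) = {i} → y = r ∧ s(x, z) ∈ ({s(↑a, ↑b)} : Set (Sym2 V)) := by
    intro x y z hxy hyz hxz i h1 h2
    rw [Set.singleton_eq_singleton_iff] at h1 h2
    have h3 : c s(y, x) = c s(y, z) := by rw [Sym2.eq_swap, h1, h2]
    by_cases hy : y = r
    swap
    · exact absurd (hinj y hy hxy.symm hyz h3) hxz
    subst hy
    refine ⟨rfl, ?_⟩
    have h4 : (e ⟨x, hxy.symm⟩).getD i₀ = (e ⟨z, hyz⟩).getD i₀ := by
      rw [← hc', ← hc']; exact h3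
    have h5 : e ⟨x, hxy.symm⟩ ≠ e ⟨z, hyz⟩ := fun h => hxz (congrArg Subtype.val (e.injective h))
    -- `getD i₀` identifies only `none` and `some i₀`.
    rcases hx : e ⟨x, hxy.symm⟩ with _ | j <;> rcases hz : e ⟨z, hyz⟩ with _ | l <;>
      rw [hx, hz] at h4 h5
    · exact absurd rfl h5
    · obtain rfl : i₀ = l := h4
      simp [ha, hb, ← hx, ← hz]
    · obtain rfl : j = i₀ := h4
      simp [ha, hb, ← hx, ← hz]
    · exact absurd (congrArg some h4) h5
  obtain ⟨f, hfa, hfb, hfinj, hf1, hf2⟩ := hT.exists_map_cliquePower hk (fun e => {c e})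
    (fun _ => Set.singleton_nonempty _) hM hp u v (by
      intro i
      simp only [p, Walk.edges_cons, Walk.edges_nil, List.mem_cons, List.not_mem_nil, or_false,
        exists_eq_or_imp, exists_eq_left, Set.mem_singleton_iff, Sym2.eq_swap (a := (a : V)), hca,
        hcb, or_self]
      exact ⟨huniq i, fun h => h ▸ hi₀⟩)
  have himg : ∀ x y, s(f x, f y) = s(u, v) ↔ s(x, y) = s(↑a, ↑b) := by
    intro x y
    simp [← hfa, ← hfb, hfinj.eq_iff]
  refine ⟨⟨⟨f, hfinj⟩, ?_⟩⟩
  intro x y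
  simp only [Function.Embedding.coeFn_mk, deleteEdges_adj, Set.mem_singleton_iff, himg]
  constructor
  · rintro ⟨h1, h2⟩
    exact (hf2 x y h1).resolve_right h2
  · refine fun h => ⟨hf1 x y h _ rfl, fun h' => ?_⟩
    have hTab : T.Adj a b := by rwa [← mem_edgeSet, ← h', mem_edgeSet]
    exact hT.not_adj_of_adj hra hrb hTab

/-- One edge at `r` is labelled by the set of at least two coordinates in which `u` and `v` differ,
and mapped to the new edge; the other edges are properly coloured. -/
theorem isIndContained_sup_edge {V : Type*} [Fintype V] {T : SimpleGraph V} (hT : T.IsTree)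
    {r : V} {n : ℕ} (e : T.neighborSet r ≃ Option (Fin n))
    (hdeg : ∀ y, y ≠ r → ∃ e : V → Fin n, Set.InjOn e (T.neighborSet y)) {k : ℕ}
    (hk : Fintype.card V ≤ k) {u v : Fin n → Fin k} (huv : (cliquePower n k)ᶜ.Adj u v) :
    T.IsIndContained (cliquePower n k ⊔ edge u v) := by
  classical
  rw [compl_adj] at huv
  obtain ⟨hne, hnadj⟩ := huv
  obtain ⟨i₀, hi₀⟩ := Function.ne_iff.1 hne
  have : Nonempty (Fin n) := ⟨i₀⟩
  obtain ⟨c, hc', hinj⟩ := hT.exists_edge_coloring r (fun x => (e x).getD i₀) hdeg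
  set a := e.symm none with ha
  have hra : T.Adj r a := a.2
  let S : Sym2 V → Set (Fin n) := fun d => if d = s(r, ↑a) then {i | u i ≠ v i} else {c d}
  have hSa : S s(r, a) = {i | u i ≠ v i} := if_pos rfl
  have hS' : ∀ d, d ≠ s(r, ↑a) → S d = {c d} := fun d hd => if_neg hd
  -- As `u` and `v` are not adjacent, the label of the edge `r a` is not a singleton.
  have hSi : ∀ d i, S d = {i} → d ≠ s(r, ↑a) ∧ c d = i := by
    intro d i h
    by_cases hd : d = s(r, ↑a)
    · rw [hd, hSa, Set.ext_iff] at h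
      exact absurd ⟨i, (h i).2 rfl, fun j hj => (h j).1 hj⟩ hnadj
    · rw [hS' d hd, Set.singleton_eq_singleton_iff] at h
      exact ⟨hd, h⟩
  have hM : ∀ x y z, T.Adj x y → T.Adj y z → x ≠ z → ∀ i, S s(x, y) = {i} →
      S s(y, z) = {i} → y = r ∧ s(x, z) ∈ (∅ : Set (Sym2 V)) := by
    intro x y z hxy hyz hxz i h1 h2
    exfalso
    obtain ⟨h1, h1'⟩ := hSi _ _ h1
    obtain ⟨h2, h2'⟩ := hSi _ _ h2
    have h3 : c s(y, x) = c s(y, z) := by rw [Sym2.eq_swap, h1', h2']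
    by_cases hy : y = r
    swap
    · exact hxz (hinj y hy hxy.symm hyz h3)
    subst hy
    have h4 : (e ⟨x, hxy.symm⟩).getD i₀ = (e ⟨z, hyz⟩).getD i₀ := by
      rw [← hc', ← hc']; exact h3
    rcases hx : e ⟨x, hxy.symm⟩ with _ | j
    · exact h1 (by simp [ha, ← hx])
    rcases hz : e ⟨z, hyz⟩ with _ | l
    · exact h2 (by simp [ha, ← hz])
    rw [hx, hz] at h4
    obtain rfl : j = l := h4
    exact hxz (congrArg Subtype.val (e.injective (hx.trans hz.symm)))
  have hp : (Walk.cons hra .nil).IsPath := by simp [hra.ne]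
  obtain ⟨f, hfr, hfa, hfinj, hf1, hf2⟩ := hT.exists_map_cliquePower hk S
    (fun d => by
      by_cases hd : d = s(r, ↑a)
      · rw [hd, hSa]; exact ⟨i₀, hi₀⟩
      · rw [hS' d hd]; exact Set.singleton_nonempty _) hM hp u v (by simp [hSa])
  have himg : ∀ x y, s(u, v) = s(f x, f y) ↔ s(x, y) = s(r, ↑a) := by
    intro x y
    rw [eq_comm]
    simp [← hfa, ← hfr, hfinj.eq_iff]
  refine ⟨⟨⟨f, hfinj⟩, ?_⟩⟩
  intro x y
  simp only [Function.Embedding.coeFn_mk, sup_adj, adj_edge, himg]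
  constructor
  · rintro (h | ⟨h, -⟩)
    · exact (hf2 x y h).resolve_right (by simp)
    · rwa [← mem_edgeSet, h, mem_edgeSet]
  · intro h
    by_cases hd : s(x, y) = s(r, ↑a)
    · exact .inr ⟨hd, hfinj.ne h.ne⟩
    · exact .inl (hf1 x y h _ (hS' _ hd))

theorem corollary2 (n : ℕ) (hn : 3 ≤ n) {V : Type*} [Fintype V] (T : SimpleGraph V)
    (hT : IsUniqueMaxTree n T) :
    ∃ k : ℕ, 2 ≤ k ∧ InducedSaturated (cliquePower n k) T := by
  classical
  obtain ⟨hT, hmax, r, hr, huniq, -⟩ := hT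
  have e : T.neighborSet r ≃ Option (Fin n) := Fintype.equivOfCardEq (by
    rw [card_neighborSet_eq_degree, Fintype.card_option, Fintype.card_fin, ← hr])
  have hdeg : ∀ y, y ≠ r → ∃ e : V → Fin n, Set.InjOn e (T.neighborSet y) := by
    intro y hy
    have h1 : T.degree y ≤ n := by
      have h2 := T.degree_le_maxDegree y
      have h3 := mt (huniq y) hy
      have h4 : T.maxDegree = n + 1 := by rw [← hmax]
      have h5 : T.degree y ≠ n + 1 := by convert h3
      omega
    obtain ⟨g⟩ := Function.Embedding.nonempty_of_card_le (α := T.neighborSet y) (β := Fin n)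
      (by rwa [card_neighborSet_eq_degree, Fintype.card_fin])
    refine ⟨fun x => if h : T.Adj y x then g ⟨x, h⟩ else ⟨0, by omega⟩, fun x hx z hz h => ?_⟩
    rw [mem_neighborSet] at hx hz
    exact congrArg Subtype.val (g.injective (by simpa [hx, hz] using h))
  exact ⟨Fintype.card V + 2, by omega, not_isIndContained_cliquePower hT e _,
    fun u v h => isIndContained_deleteEdges hT e hdeg (by omega) h,
    fun u v h => isIndContained_sup_edge hT e hdeg (by omega) h⟩
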